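/- Let $\xi_0,\xi_1,\xi_2,\dots$ be independent standard normal random variables and, for $n\ge 1$, let $$P_n(x)=\sum_{k=0}^n \frac{\xi_k}{\sqrt{k!}}\,x^k .$$ For $I\subset\mathbb R$ let $N_n(I)$ be the number of real roots of $P_n$ in $I$, counted with multiplicity, and let $|\cdot|$ denote Lebesgue measure on $\mathbb R$. Then there are an absolute constant $A>0$ and a deterministic sequence $\varepsilon_n\to 0$ such that for every $C>0$ there is a constant $K_C>0$, depending only on $C$, with the following property: for every $n\ge 1$, with probability at least $1-K_C\,n^{-C}$, the polynomial $P_n$ is not identically zero and $$N_n(I)\le A\,\bigl(1+\bigl|I\cap[-\sqrt n,\sqrt n]\bigr|\bigr)\,n^{\varepsilon_n}\qquad\text{for all intervals } I\subset\mathbb R \text{ simultaneously.}$$ -/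

import Mathlib

open MeasureTheory ProbabilityTheory Filter Topology

noncomputable section

/-- The polynomial `∑_{k=0}^n (a_k / √(k!)) x^k` with real coefficients. For `a = (ξ_k(ω))_k` it is
the value at `ω` of the random Weyl polynomial `P_n`. -/
def weylPolynomial (n : ℕ) (a : ℕ → ℝ) : Polynomial ℝ :=
  ∑ k ∈ Finset.range (n + 1),
    Polynomial.C (a k / Real.sqrt (Nat.factorial k : ℝ)) * Polynomial.X ^ k

open Classical in
/-- The number of real roots in `I` of a nonzero real polynomial `p`, counted with multiplicity.
(For `p = 0` the value is the junk value `0`; the event `LocalLaw` below excludes `p = 0`.) -/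
def realRootCount (p : Polynomial ℝ) (I : Set ℝ) : ℕ :=
  (p.roots.filter (fun x => x ∈ I)).card

/-- The local law for `p` at level `n` with bound `B`: `p` is not the zero polynomial, and every
interval `I` (bounded or not, open, closed or half-open, possibly degenerate) contains at most
`(1 + |I ∩ [-√n, √n]|) B` real roots of `p`, where `|·|` is Lebesgue measure. -/
def LocalLaw (n : ℕ) (p : Polynomial ℝ) (B : ℝ) : Prop :=
  p ≠ 0 ∧ ∀ I : Set ℝ, I.OrdConnected →
    (realRootCount p I : ℝ) ≤
      (1 + volume.real (I ∩ Set.Icc (-Real.sqrt (n : ℝ)) (Real.sqrt (n : ℝ)))) * B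

end

/-! Roots are counted in small discs by a Jensen-type bound (`four_pow_card_roots_le`): if a disc of
radius `r` about `c` contains `N` roots, then `4 ^ N` is at most the ratio of the maximum of the
squared modulus on the circle of radius `3 * r` to its value at `c`. The maximum comes from
Cauchy–Schwarz and a bound `T` on `∑ ξ_k ^ 2`; the value at `c` is a centred Gaussian, so outside an
event of probability at most `δ` its square is at least `δ ^ 2` times its variance. With `T` and `1
/ δ` powers of `n`, a ratio polynomial in `n` gives `N = O(log n)`.

The ratio is polynomial in two regimes. Near a point `x` of `[-√n, √n]`, multiplying by `exp (-x z)`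
makes `exp (|z| ^ 2)`, which bounds the variance profile, constant on circles about `x`; the
truncated series loses only a factor `n + 3`. Roots with `|x| > √n` are inverted into `|v| < 1 /
√n`, where the reflected polynomial has a variance profile comparable with `1 / n!` up to a factor
linear in `n`. There `O(log n)` discs, shrinking dyadically towards `±1 / √n`, suffice.

The good event involves only finitely many fixed centres, so it serves all intervals at once
(`localLaw_of_bounds`), and a union bound controls its complement. The resulting factor `O((log n) ^
2)`, whose constant depends on `C`, is absorbed by `n ^ ε_n = exp √(log n)` once `n` is large in
terms of `C`. -/

/-! ### Counting roots through the maximum principle -/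

/-- Each linear factor is at least `2 * r` on the circle and at most `r` at the centre, so it gains
a factor 2. The maximum principle for the zero-stripped function `g` transfers the bound from circle
to centre. -/
theorem four_pow_card_mul_sq_norm_le {S : Multiset ℝ} {c r M : ℝ} {g : ℂ → ℂ} (hr : 0 < r)
    (hg : Differentiable ℂ g) (hS : ∀ a ∈ S, |a - c| ≤ r)
    (hM : ∀ z : ℂ, ‖z - c‖ = 3 * r → ‖(S.map fun a : ℝ => z - a).prod * g z‖ ^ 2 ≤ M) :
    (4 : ℝ) ^ S.card * ‖(S.map fun a : ℝ => (c : ℂ) - a).prod * g c‖ ^ 2 ≤ M := by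
  have hM0 : 0 ≤ M := by
    refine le_trans (sq_nonneg _) (hM (c + (3 * r : ℝ)) ?_)
    rw [add_sub_cancel_left, Complex.norm_real, Real.norm_of_nonneg (by positivity)]
  have hin : ∀ T : Multiset ℝ, (∀ a ∈ T, |a - c| ≤ r) →
      ‖(T.map fun a : ℝ => (c : ℂ) - a).prod‖ ≤ r ^ T.card := by
    intro T
    induction T using Multiset.induction_on with
    | empty => simp
    | cons a T ih =>
      intro h
      have h1 : ‖(c : ℂ) - a‖ ≤ r := by
        rw [← Complex.ofReal_sub, Complex.norm_real, Real.norm_eq_abs, abs_sub_comm]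
        exact h a (by simp)
      have h2 := ih fun b hb => h b (by simp [hb])
      rw [Multiset.map_cons, Multiset.prod_cons, norm_mul, Multiset.card_cons, pow_succ']
      gcongr
  have hout : ∀ z : ℂ, ‖z - c‖ = 3 * r → ∀ T : Multiset ℝ, (∀ a ∈ T, |a - c| ≤ r) →
      (2 * r) ^ T.card ≤ ‖(T.map fun a : ℝ => z - a).prod‖ := by
    intro z hz T
    induction T using Multiset.induction_on with
    | empty => simp
    | cons a T ih =>
      intro h
      have h1 : 2 * r ≤ ‖z - a‖ := by
        have h3 : ‖(a : ℂ) - c‖ ≤ r := by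
          rw [← Complex.ofReal_sub, Complex.norm_real, Real.norm_eq_abs]
          exact h a (by simp)
        have h5 : ‖z - c‖ ≤ ‖z - a‖ + ‖(a : ℂ) - c‖ := by
          simpa using norm_add_le (z - a) ((a : ℂ) - c)
        linarith
      have h2 := ih fun b hb => h b (by simp [hb])
      rw [Multiset.map_cons, Multiset.prod_cons, norm_mul, Multiset.card_cons, pow_succ']
      gcongr
  have hgc : ‖g c‖ ≤ √M / (2 * r) ^ S.card := by
    refine Complex.norm_le_of_forall_mem_frontier_norm_le (U := Metric.ball (c : ℂ) (3 * r))
      Metric.isBounded_ball hg.diffContOnCl (fun z hz => ?_) (subset_closure (by simpa using hr))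
    rw [frontier_ball _ (by positivity), mem_sphere_iff_norm] at hz
    have h1 := hM z hz
    rw [norm_mul] at h1
    have h2 := Real.le_sqrt_of_sq_le h1
    rw [le_div_iff₀ (by positivity)]
    calc ‖g z‖ * (2 * r) ^ S.card ≤ ‖g z‖ * ‖(S.map fun a : ℝ => z - a).prod‖ := by
          gcongr; exact hout z hz S hS
      _ ≤ √M := by rw [mul_comm]; exact h2
  have h1 : 2 ^ S.card * ‖(S.map fun a : ℝ => (c : ℂ) - a).prod * g c‖ ≤ √M := by
    calc 2 ^ S.card * ‖(S.map fun a : ℝ => (c : ℂ) - a).prod * g c‖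
        ≤ 2 ^ S.card * (r ^ S.card * (√M / (2 * r) ^ S.card)) := by
          rw [norm_mul]; gcongr; exact hin S hS
      _ = √M := by rw [mul_pow]; field_simp
  calc (4 : ℝ) ^ S.card * ‖(S.map fun a : ℝ => (c : ℂ) - a).prod * g c‖ ^ 2
      = (2 ^ S.card * ‖(S.map fun a : ℝ => (c : ℂ) - a).prod * g c‖) ^ 2 := by
        rw [mul_pow, ← pow_mul, mul_comm S.card, pow_mul]; norm_num
    _ ≤ √M ^ 2 := by gcongr
    _ = M := Real.sq_sqrt hM0

theorem four_pow_card_roots_le {p : Polynomial ℝ} (hp : p ≠ 0) {S : Multiset ℝ}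
    (hSp : S ≤ p.roots) {c r M : ℝ} {h : ℂ → ℂ} (hr : 0 < r)
    (hh : Differentiable ℂ h) (hS : ∀ a ∈ S, |a - c| ≤ r)
    (hM : ∀ z : ℂ, ‖z - c‖ = 3 * r → ‖Polynomial.aeval z p * h z‖ ^ 2 ≤ M) :
    (4 : ℝ) ^ S.card * (p.eval c ^ 2 * ‖h c‖ ^ 2) ≤ M := by
  obtain ⟨q, hq⟩ := (Multiset.prod_X_sub_C_dvd_iff_le_roots hp S).2 hSp
  have key : ∀ z : ℂ, Polynomial.aeval z p * h z
      = (S.map fun a : ℝ => z - a).prod * (Polynomial.aeval z q * h z) := by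
    intro z
    rw [hq, map_mul, map_multiset_prod, Multiset.map_map, mul_assoc]
    simp
  have h1 := four_pow_card_mul_sq_norm_le (S := S) (c := c) (M := M)
    (g := fun z => Polynomial.aeval z q * h z) hr
    ((Polynomial.differentiable_aeval q).mul hh) hS (fun z hz => by rw [← key]; exact hM z hz)
  rw [← key, norm_mul, mul_pow] at h1
  convert h1 using 3
  rw [← Complex.coe_algebraMap, Polynomial.aeval_algebraMap_apply]
  simp

/-! ### The reflected polynomial -/

/-- Reflection is multiplicative under degree bounds and sends `X - a` to `-a * (X - a⁻¹)`. Arguing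
by divisibility keeps multiplicities; the slack in `m` allows a vanishing leading coefficient. -/
theorem prod_X_sub_C_inv_dvd_reflect (S : Multiset ℝ) (hS : ∀ a ∈ S, a ≠ 0) :
    ∀ {q : Polynomial ℝ} {m : ℕ}, q.natDegree ≤ m →
      ((S.map fun a => a⁻¹).map fun a => Polynomial.X - Polynomial.C a).prod ∣
        ((S.map fun a => Polynomial.X - Polynomial.C a).prod * q).reflect (S.card + m) := by
  induction S using Multiset.induction_on with
  | empty => simp
  | cons a S ih =>
    intro q m hq
    have ha : a ≠ 0 := hS a (by simp)
    have h1 := ih (fun b hb => hS b (by simp [hb])) hq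
    have hd : ((S.map fun a => Polynomial.X - Polynomial.C a).prod * q).natDegree
        ≤ S.card + m := by
      refine Polynomial.natDegree_mul_le.trans ?_
      rw [Polynomial.natDegree_multiset_prod_X_sub_C_eq_card]
      omega
    have e : (Polynomial.X - Polynomial.C a).reflect 1
        = Polynomial.C (-a) * (Polynomial.X - Polynomial.C a⁻¹) := by
      rw [Polynomial.reflect_sub, Polynomial.reflect_one_X, Polynomial.reflect_C, mul_sub,
        ← Polynomial.C_mul]
      simp [ha]
      ring
    rw [Multiset.card_cons, Multiset.map_cons, Multiset.map_cons, Multiset.map_cons,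
      Multiset.prod_cons, Multiset.prod_cons, mul_assoc, show S.card + 1 + m = 1 + (S.card + m) by ring,
      Polynomial.reflect_mul _ _ (Polynomial.natDegree_X_sub_C_le a) hd, e, mul_assoc]
    exact Dvd.dvd.mul_left (mul_dvd_mul_left _ h1) _

theorem map_inv_le_roots_reflect {p : Polynomial ℝ} (hp : p ≠ 0) {n : ℕ} (hn : p.natDegree ≤ n)
    {S : Multiset ℝ} (hSp : S ≤ p.roots) (hS : ∀ a ∈ S, a ≠ 0) :
    S.map (fun a => a⁻¹) ≤ (p.reflect n).roots := by
  rw [← Multiset.prod_X_sub_C_dvd_iff_le_roots (by simpa using hp)]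
  obtain ⟨q, hq⟩ := (Multiset.prod_X_sub_C_dvd_iff_le_roots hp S).2 hSp
  have hq0 : q ≠ 0 := by rintro rfl; simp [hp] at hq
  have hd : p.natDegree = S.card + q.natDegree := by
    rw [hq, Polynomial.Monic.natDegree_mul' (Polynomial.monic_multiset_prod_of_monic _ _
      fun a _ => Polynomial.monic_X_sub_C a) hq0, Polynomial.natDegree_multiset_prod_X_sub_C_eq_card]
  have h := prod_X_sub_C_inv_dvd_reflect S hS (q := q) (m := n - S.card) (by omega)
  rwa [← hq, show S.card + (n - S.card) = n by omega] at h

/-! ### The Weyl polynomial -/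

theorem natDegree_weylPolynomial_le (n : ℕ) (a : ℕ → ℝ) : (weylPolynomial n a).natDegree ≤ n := by
  refine Polynomial.natDegree_sum_le_of_forall_le _ _ fun k hk => ?_
  exact (Polynomial.natDegree_C_mul_X_pow_le _ _).trans (by simpa [Nat.lt_succ_iff] using hk)

theorem eval_weylPolynomial (n : ℕ) (a : ℕ → ℝ) (x : ℝ) :
    (weylPolynomial n a).eval x = ∑ k ∈ Finset.range (n + 1), x ^ k / √(k.factorial : ℝ) * a k := by
  simp only [weylPolynomial, Polynomial.eval_finsetSum, Polynomial.eval_mul, Polynomial.eval_C,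
    Polynomial.eval_pow, Polynomial.eval_X]
  exact Finset.sum_congr rfl fun k _ => by ring

theorem aeval_weylPolynomial (n : ℕ) (a : ℕ → ℝ) (z : ℂ) :
    Polynomial.aeval z (weylPolynomial n a)
      = ∑ k ∈ Finset.range (n + 1), (a k : ℂ) * (z ^ k / (√(k.factorial : ℝ) : ℝ)) := by
  simp only [weylPolynomial, map_sum, map_mul, Polynomial.aeval_C, map_pow, Polynomial.aeval_X,
    Complex.coe_algebraMap, Complex.ofReal_div]
  exact Finset.sum_congr rfl fun k _ => by ring

theorem reflect_weylPolynomial (n : ℕ) (a : ℕ → ℝ) :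
    (weylPolynomial n a).reflect n = ∑ k ∈ Finset.range (n + 1),
      Polynomial.C (a k / √(k.factorial : ℝ)) * Polynomial.X ^ (n - k) := by
  have h : ∀ (s : Finset ℕ) (f : ℕ → Polynomial ℝ),
      (∑ k ∈ s, f k).reflect n = ∑ k ∈ s, (f k).reflect n := by
    intro s f
    induction s using Finset.induction_on with
    | empty => simp
    | insert k s hk ih => rw [Finset.sum_insert hk, Finset.sum_insert hk, Polynomial.reflect_add, ih]
  rw [weylPolynomial, h]
  refine Finset.sum_congr rfl fun k hk => ?_
  rw [Polynomial.reflect_C_mul_X_pow, Polynomial.revAt_le (by simpa [Nat.lt_succ_iff] using hk)]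

theorem eval_reflect_weylPolynomial (n : ℕ) (a : ℕ → ℝ) (x : ℝ) :
    ((weylPolynomial n a).reflect n).eval x
      = ∑ k ∈ Finset.range (n + 1), x ^ (n - k) / √(k.factorial : ℝ) * a k := by
  simp only [reflect_weylPolynomial, Polynomial.eval_finsetSum, Polynomial.eval_mul,
    Polynomial.eval_C, Polynomial.eval_pow, Polynomial.eval_X]
  exact Finset.sum_congr rfl fun k _ => by ring

theorem aeval_reflect_weylPolynomial (n : ℕ) (a : ℕ → ℝ) (z : ℂ) :
    Polynomial.aeval z ((weylPolynomial n a).reflect n)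
      = ∑ k ∈ Finset.range (n + 1), (a k : ℂ) * (z ^ (n - k) / (√(k.factorial : ℝ) : ℝ)) := by
  simp only [reflect_weylPolynomial, map_sum, map_mul, Polynomial.aeval_C, map_pow,
    Polynomial.aeval_X, Complex.coe_algebraMap, Complex.ofReal_div]
  exact Finset.sum_congr rfl fun k _ => by ring

theorem sq_norm_sum_ofReal_mul_le (s : Finset ℕ) (a : ℕ → ℝ) (b : ℕ → ℂ) :
    ‖∑ k ∈ s, (a k : ℂ) * b k‖ ^ 2 ≤ (∑ k ∈ s, a k ^ 2) * ∑ k ∈ s, ‖b k‖ ^ 2 := by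
  calc ‖∑ k ∈ s, (a k : ℂ) * b k‖ ^ 2 ≤ (∑ k ∈ s, |a k| * ‖b k‖) ^ 2 := by
        gcongr
        refine (norm_sum_le _ _).trans_eq (Finset.sum_congr rfl fun k _ => ?_)
        rw [norm_mul, Complex.norm_real, Real.norm_eq_abs]
    _ ≤ _ := by
        simpa only [sq_abs] using Finset.sum_mul_sq_le_sq_mul_sq s (fun k => |a k|) fun k => ‖b k‖

/-- Truncating the exponential series at `n ≥ y` loses at most a factor `n + 3`. -/
theorem exp_le_mul_sum_pow_div_factorial {n : ℕ} {y : ℝ} (hy : 0 ≤ y) (hyn : y ≤ n) :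
    Real.exp y ≤ (n + 3) * ∑ k ∈ Finset.range (n + 1), y ^ k / k.factorial := by
  set t : ℕ → ℝ := fun k => y ^ k / k.factorial with ht
  have ht0 : ∀ k, 0 ≤ t k := fun k => by positivity
  have hsum : Summable t := Real.summable_pow_div_factorial y
  have hstep : ∀ k, t (k + 1) = t k * (y / (k + 1)) := by
    intro k
    simp only [ht, Nat.factorial_succ, pow_succ]
    push_cast
    field_simp
  -- Since `y ≤ n`, terms decrease from index `n` on, and beyond `2 * n` they at least halve. The
  -- tail therefore costs `n + 2` copies of `t n`.
  have hmono : ∀ j, t (n + j) ≤ t n := by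
    intro j
    induction j with
    | zero => simp
    | succ j ih =>
      rw [← add_assoc, hstep]
      refine (mul_le_of_le_one_right (ht0 _) ?_).trans ih
      rw [div_le_one (by positivity)]
      push_cast
      linarith [(Nat.cast_nonneg j : (0 : ℝ) ≤ j)]
  have hgeo : ∀ j, t (2 * n + 1 + j) ≤ t n * (1 / 2) ^ j := by
    intro j
    induction j with
    | zero => simpa [show 2 * n + 1 = n + (n + 1) by ring] using hmono (n + 1)
    | succ j ih =>
      rw [← add_assoc, hstep, pow_succ, ← mul_assoc]
      refine mul_le_mul ih ?_ (by positivity) (mul_nonneg (ht0 n) (by positivity))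
      rw [div_le_div_iff₀ (by positivity) (by positivity)]
      push_cast
      linarith [(Nat.cast_nonneg j : (0 : ℝ) ≤ j)]
  have hexp : Real.exp y = ∑' k, t k := by
    rw [Real.exp_eq_exp_ℝ, NormedSpace.exp_eq_tsum_div]
  have htail : ∑' j, t (j + (2 * n + 1)) ≤ 2 * t n := by
    have h1 : HasSum (fun j : ℕ => t n * (1 / 2 : ℝ) ^ j) (t n * 2) :=
      hasSum_geometric_two.mul_left _
    have h2 := ((summable_nat_add_iff (2 * n + 1)).2 hsum).tsum_le_tsum
      (fun j => by rw [add_comm]; exact hgeo j) h1.summable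
    rw [h1.tsum_eq] at h2
    linarith
  have hmid : ∑ k ∈ Finset.range (2 * n + 1), t k
      ≤ ∑ k ∈ Finset.range (n + 1), t k + n * t n := by
    rw [show 2 * n + 1 = (n + 1) + n by ring, Finset.sum_range_add]
    gcongr
    calc ∑ x ∈ Finset.range n, t (n + 1 + x) ≤ ∑ x ∈ Finset.range n, t n :=
          Finset.sum_le_sum fun x _ => by rw [add_assoc]; exact hmono _
      _ = n * t n := by simp
  have hn : t n ≤ ∑ k ∈ Finset.range (n + 1), t k :=
    Finset.single_le_sum (fun k _ => ht0 k) (by simp)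
  rw [hexp, ← hsum.sum_add_tsum_nat_add (2 * n + 1)]
  have h3 : ((n : ℝ) + 2) * t n ≤ (n + 2) * ∑ k ∈ Finset.range (n + 1), t k := by gcongr
  linarith

/-! ### Local root counts for the Weyl polynomial and its reflection -/

/-- Local root count near a point of `[-√n, √n]`. -/
theorem weylPolynomial_card_roots_near_le {n : ℕ} {a : ℕ → ℝ} {T δ x : ℝ} {S : Multiset ℝ}
    (hp : weylPolynomial n a ≠ 0) (hSp : S ≤ (weylPolynomial n a).roots)
    (hT : ∑ k ∈ Finset.range (n + 1), a k ^ 2 ≤ T) (hx : x ^ 2 ≤ n)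
    (hS : ∀ b ∈ S, |b - x| ≤ 1)
    (hδ : δ ^ 2 * ∑ k ∈ Finset.range (n + 1), (x ^ k / √(k.factorial : ℝ)) ^ 2
      ≤ (weylPolynomial n a).eval x ^ 2) :
    4 ^ S.card * δ ^ 2 ≤ T * Real.exp 9 * (n + 3) := by
  have hsq : ∀ k : ℕ, √(k.factorial : ℝ) ^ 2 = k.factorial := fun k => Real.sq_sqrt (by positivity)
  have hT0 : 0 ≤ T := le_trans (by positivity) hT
  have h1 := four_pow_card_roots_le hp hSp (c := x) (r := 1) (M := T * Real.exp (9 - x ^ 2))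
    (h := fun z => Complex.exp (-(x * z))) one_pos (by fun_prop) hS (by
      intro z hz
      have h2 : ∑ k ∈ Finset.range (n + 1), ‖z ^ k / ((√(k.factorial : ℝ) : ℝ) : ℂ)‖ ^ 2
          ≤ Real.exp (‖z‖ ^ 2) := by
        refine le_trans (le_of_eq (Finset.sum_congr rfl fun k _ => ?_))
          (Real.sum_le_exp_of_nonneg (sq_nonneg ‖z‖) (n + 1))
        rw [norm_div, norm_pow, Complex.norm_real, Real.norm_of_nonneg (Real.sqrt_nonneg _),
          div_pow, hsq, ← pow_mul, ← pow_mul, mul_comm]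
      -- Completing the square: the left side is `‖z - x‖ ^ 2 - x ^ 2`, constant on the circle. This
      -- dictates the factor `exp (-x z)`.
      have h3 : ‖z‖ ^ 2 - 2 * x * z.re = 9 - x ^ 2 := by
        have h4 : ‖z - x‖ ^ 2 = 9 := by rw [hz]; norm_num
        rw [← Complex.normSq_eq_norm_sq, Complex.normSq_apply] at h4 ⊢
        simp at h4
        linarith
      have h5 : ‖Complex.exp (-(x * z))‖ ^ 2 = Real.exp (-(2 * x * z.re)) := by
        rw [Complex.norm_exp, ← Real.exp_nat_mul]
        congr 1
        simp
        ring
      rw [norm_mul, mul_pow, h5, aeval_weylPolynomial, ← h3, sub_eq_add_neg, Real.exp_add,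
        ← mul_assoc]
      gcongr
      refine (sq_norm_sum_ofReal_mul_le _ _ _).trans ?_
      gcongr)
  have h6 : ‖Complex.exp (-((x : ℂ) * x))‖ ^ 2 = Real.exp (-(2 * x ^ 2)) := by
    rw [Complex.norm_exp, ← Real.exp_nat_mul]
    congr 1
    simp
    ring
  simp only [h6] at h1
  have h7 : ∑ k ∈ Finset.range (n + 1), (x ^ k / √(k.factorial : ℝ)) ^ 2
      = ∑ k ∈ Finset.range (n + 1), (x ^ 2) ^ k / (k.factorial : ℝ) :=
    Finset.sum_congr rfl fun k _ => by rw [div_pow, hsq, ← pow_mul, ← pow_mul, mul_comm]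
  have h8 := exp_le_mul_sum_pow_div_factorial (sq_nonneg x) hx
  rw [h7] at hδ
  set V := ∑ k ∈ Finset.range (n + 1), (x ^ 2) ^ k / (k.factorial : ℝ)
  have e1 : Real.exp (9 - x ^ 2) = Real.exp 9 * Real.exp (-x ^ 2) := by
    rw [← Real.exp_add]; ring_nf
  have e2 : Real.exp (x ^ 2) * Real.exp (-(2 * x ^ 2)) = Real.exp (-x ^ 2) := by
    rw [← Real.exp_add]; ring_nf
  have h9 : 4 ^ S.card * δ ^ 2 * Real.exp (-x ^ 2)
      ≤ (T * Real.exp 9 * (n + 3)) * Real.exp (-x ^ 2) := by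
    calc 4 ^ S.card * δ ^ 2 * Real.exp (-x ^ 2)
        = 4 ^ S.card * δ ^ 2 * Real.exp (x ^ 2) * Real.exp (-(2 * x ^ 2)) := by
          rw [mul_assoc _ (Real.exp (x ^ 2)), e2]
      _ ≤ 4 ^ S.card * δ ^ 2 * ((n + 3) * V) * Real.exp (-(2 * x ^ 2)) := by gcongr
      _ = (n + 3) * (4 ^ S.card * ((δ ^ 2 * V) * Real.exp (-(2 * x ^ 2)))) := by ring
      _ ≤ (n + 3) * (4 ^ S.card * ((weylPolynomial n a).eval x ^ 2 * Real.exp (-(2 * x ^ 2)))) := by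
          gcongr
      _ ≤ (n + 3) * (T * Real.exp (9 - x ^ 2)) := by gcongr
      _ = _ := by rw [e1]; ring
  exact le_of_mul_le_mul_right h9 (Real.exp_pos _)

/-- Local root count of the reflected polynomial in a disc inside `|v| ≤ (1 + 1/n) / √n`. -/
theorem reflect_weylPolynomial_card_roots_near_le {n : ℕ} (hn : 1 ≤ n) {a : ℕ → ℝ} {T δ c r : ℝ}
    {S : Multiset ℝ} (hp : weylPolynomial n a ≠ 0) (hr : 0 < r)
    (hSp : S ≤ ((weylPolynomial n a).reflect n).roots)
    (hT : ∑ k ∈ Finset.range (n + 1), a k ^ 2 ≤ T) (hc : |c| + 3 * r ≤ (1 + 1 / n) / √n)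
    (hS : ∀ b ∈ S, |b - c| ≤ r)
    (hδ : δ ^ 2 * ∑ k ∈ Finset.range (n + 1), (c ^ (n - k) / √(k.factorial : ℝ)) ^ 2
      ≤ ((weylPolynomial n a).reflect n).eval c ^ 2) :
    4 ^ S.card * δ ^ 2 ≤ T * Real.exp 2 * (n + 1) := by
  have hn0 : (0 : ℝ) < n := by exact_mod_cast hn
  have hsq : ∀ k : ℕ, √(k.factorial : ℝ) ^ 2 = k.factorial := fun k => Real.sq_sqrt (by positivity)
  have hT0 : 0 ≤ T := le_trans (by positivity) hT
  have h1 := four_pow_card_roots_le (p := (weylPolynomial n a).reflect n) (by simpa using hp) hSp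
    (M := T * ((n + 1) * (Real.exp 2 / n.factorial))) (h := fun _ => 1) hr (by fun_prop) hS (by
      intro z hz
      have hz1 : ‖z‖ ≤ (1 + 1 / n) / √n := by
        refine le_trans ?_ hc
        calc ‖z‖ = ‖(z - c) + c‖ := by simp
          _ ≤ ‖z - c‖ + ‖(c : ℂ)‖ := norm_add_le _ _
          _ = |c| + 3 * r := by rw [hz, Complex.norm_real, Real.norm_eq_abs, add_comm]
      have hz2 : ‖z‖ ^ 2 ≤ (1 + 1 / n) ^ 2 / n := by
        calc ‖z‖ ^ 2 ≤ ((1 + 1 / n) / √n) ^ 2 := by gcongr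
          _ = _ := by rw [div_pow, Real.sq_sqrt hn0.le]
      have hterm : ∀ k ∈ Finset.range (n + 1),
          ‖z ^ (n - k) / ((√(k.factorial : ℝ) : ℝ) : ℂ)‖ ^ 2 ≤ Real.exp 2 / n.factorial := by
        intro k hk
        have hk' : k ≤ n := by simpa [Nat.lt_succ_iff] using hk
        -- The power `n ^ (n - k)` is exactly what `‖z‖ ^ 2 ≤ (1 + 1/n) ^ 2 / n` compensates; the
        -- excess `(1 + 1/n) ^ (2n)` stays below `exp 2`.
        have hf : (n.factorial : ℝ) ≤ k.factorial * (n : ℝ) ^ (n - k) := by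
          have h3 := Nat.factorial_mul_descFactorial (Nat.sub_le n k)
          rw [Nat.sub_sub_self hk'] at h3
          rw [← h3]
          exact_mod_cast Nat.mul_le_mul_left _ (Nat.descFactorial_le_pow n (n - k))
        have he : ((1 + 1 / (n : ℝ)) ^ 2) ^ (n - k) ≤ Real.exp 2 := by
          calc ((1 + 1 / (n : ℝ)) ^ 2) ^ (n - k) ≤ ((1 + 1 / (n : ℝ)) ^ 2) ^ n := by
                refine pow_le_pow_right₀ (one_le_pow₀ ?_) (Nat.sub_le _ _)
                have : 0 < 1 / (n : ℝ) := by positivity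
                linarith
            _ ≤ (Real.exp (1 / n) ^ 2) ^ n := by
                gcongr
                rw [add_comm]
                exact Real.add_one_le_exp _
            _ = Real.exp 2 := by
                rw [← pow_mul, ← Real.exp_nat_mul]
                congr 1
                push_cast
                field_simp
        rw [norm_div, norm_pow, Complex.norm_real, Real.norm_of_nonneg (Real.sqrt_nonneg _),
          div_pow, hsq, ← pow_mul, mul_comm, pow_mul, div_le_div_iff₀ (by positivity) (by positivity)]
        calc (‖z‖ ^ 2) ^ (n - k) * (n.factorial : ℝ)
            ≤ ((1 + 1 / n) ^ 2 / n) ^ (n - k) * (k.factorial * (n : ℝ) ^ (n - k)) := by gcongr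
          _ = ((1 + 1 / (n : ℝ)) ^ 2) ^ (n - k) * k.factorial := by
              rw [div_pow]; field_simp
          _ ≤ _ := by gcongr
      rw [mul_one, aeval_reflect_weylPolynomial]
      refine (sq_norm_sum_ofReal_mul_le _ _ _).trans ?_
      gcongr
      refine (Finset.sum_le_sum hterm).trans_eq ?_
      simp)
  -- The `k = n` term alone bounds the variance below, uniformly in `c`.
  have h2 : 1 / (n.factorial : ℝ)
      ≤ ∑ k ∈ Finset.range (n + 1), (c ^ (n - k) / √(k.factorial : ℝ)) ^ 2 := by
    refine le_trans (le_of_eq ?_)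
      (Finset.single_le_sum (f := fun k => (c ^ (n - k) / √(k.factorial : ℝ)) ^ 2)
        (fun k _ => sq_nonneg _) (Finset.mem_range.2 (Nat.lt_succ_self n)))
    simp only [Nat.sub_self, pow_zero, div_pow, hsq, one_pow]
  rw [norm_one, one_pow, mul_one] at h1
  have hfac : (0 : ℝ) < n.factorial := by positivity
  have h9 : 4 ^ S.card * δ ^ 2 * (1 / (n.factorial : ℝ))
      ≤ (T * Real.exp 2 * (n + 1)) * (1 / (n.factorial : ℝ)) := by
    calc 4 ^ S.card * δ ^ 2 * (1 / (n.factorial : ℝ))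
        ≤ 4 ^ S.card * δ ^ 2 *
            ∑ k ∈ Finset.range (n + 1), (c ^ (n - k) / √(k.factorial : ℝ)) ^ 2 := by gcongr
      _ ≤ 4 ^ S.card * ((weylPolynomial n a).reflect n).eval c ^ 2 := by rw [mul_assoc]; gcongr
      _ ≤ _ := h1
      _ = _ := by ring
  exact le_of_mul_le_mul_right h9 (by positivity)

/-! ### Coverings and the deterministic root count -/

theorem Multiset.card_le_card_mul_of_cover {α ι : Type*} {S : Multiset α} {F : Finset ι} {L : ℕ}
    (B : ι → α → Prop) [∀ i, DecidablePred (B i)] (hcov : ∀ a ∈ S, ∃ i ∈ F, B i a)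
    (hL : ∀ i ∈ F, (S.filter (B i)).card ≤ L) : S.card ≤ F.card * L := by
  have h : S.card ≤ ∑ i ∈ F, (S.filter (B i)).card := by
    clear hL
    induction S using Multiset.induction_on with
    | empty => simp
    | cons a S ih =>
      obtain ⟨i, hi, hia⟩ := hcov a (by simp)
      have h1 := ih fun b hb => hcov b (by simp [hb])
      have h2 : ∑ i ∈ F, (S.filter (B i)).card < ∑ i ∈ F, ((a ::ₘ S).filter (B i)).card := by
        refine Finset.sum_lt_sum (fun j _ => ?_) ⟨i, hi, ?_⟩
        · exact Multiset.card_le_card (Multiset.filter_le_filter _ (Multiset.le_cons_self S a))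
        · rw [Multiset.filter_cons_of_pos _ hia, Multiset.card_cons]
          exact Nat.lt_succ_self _
      rw [Multiset.card_cons]
      omega
  refine h.trans ((Finset.sum_le_sum hL).trans_eq ?_)
  simp

/-- The integers of `[-√n, √n]`. -/
noncomputable def innerCenters (n : ℕ) : Finset ℝ :=
  (Finset.Icc (-(Nat.sqrt n : ℤ)) (Nat.sqrt n)).image (Int.cast : ℤ → ℝ)

/-- The points `±(1 - 2⁻ᵏ) / √n` with `k ≤ log₂ n + 2`. -/
noncomputable def outerCenters (n : ℕ) : Finset ℝ :=
  (Finset.range (Nat.log 2 n + 3) ×ˢ ({1, -1} : Finset ℝ)).image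
    fun i => i.2 * (1 - (1 / 2) ^ i.1) / √n

theorem card_innerCenters_le (n : ℕ) : (innerCenters n).card ≤ 2 * Nat.sqrt n + 1 := by
  refine Finset.card_image_le.trans ?_
  rw [Int.card_Icc]
  omega

theorem card_outerCenters_le (n : ℕ) : (outerCenters n).card ≤ (Nat.log 2 n + 3) * 2 := by
  refine Finset.card_image_le.trans ?_
  rw [Finset.card_product, Finset.card_range]
  exact Nat.mul_le_mul_left _ Finset.card_le_two

theorem sq_le_of_abs_le_natSqrt {n : ℕ} {j : ℤ} (h1 : -(Nat.sqrt n : ℤ) ≤ j)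
    (h2 : j ≤ Nat.sqrt n) : (j : ℝ) ^ 2 ≤ n := by
  have h3 : j ^ 2 ≤ (Nat.sqrt n : ℤ) ^ 2 := sq_le_sq' h1 h2
  have h4 : ((Nat.sqrt n : ℤ)) ^ 2 ≤ n := by exact_mod_cast Nat.sqrt_le' n
  exact_mod_cast h3.trans h4

/-- The intervals `[2/3 * 2⁻ᵏ, 4/3 * 2⁻ᵏ]` abut, because halving the right end of one gives its left
end. -/
theorem exists_abs_sub_half_pow_le {s : ℝ} (hs : s ≤ 4 / 3) :
    ∀ m : ℕ, 2 / 3 * (1 / 2 : ℝ) ^ m ≤ s → ∃ k ≤ m, |s - (1 / 2) ^ k| ≤ (1 / 2) ^ k / 3 := by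
  intro m
  induction m with
  | zero =>
    intro h
    refine ⟨0, le_rfl, ?_⟩
    rw [abs_le]
    constructor <;> norm_num at h ⊢ <;> linarith
  | succ m ih =>
    intro h
    by_cases h1 : 2 / 3 * (1 / 2 : ℝ) ^ m ≤ s
    · obtain ⟨k, hk, h2⟩ := ih h1
      exact ⟨k, hk.trans (Nat.le_succ m), h2⟩
    · refine ⟨m + 1, le_rfl, ?_⟩
      rw [abs_le]
      rw [pow_succ] at h ⊢
      constructor <;> linarith

/-- The discs around the points `±(1 - 2⁻ᵏ) / √n` used to cover `[-1/√n, 1/√n]` have this radius. -/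
noncomputable def outerRadius (n k : ℕ) : ℝ :=
  (if k = Nat.log 2 n + 2 then (1 / 2) ^ k else (1 / 2) ^ k / 3) / √n

theorem outerRadius_pos {n : ℕ} (hn : 1 ≤ n) (k : ℕ) : 0 < outerRadius n k := by
  have hn0 : (0 : ℝ) < n := by exact_mod_cast hn
  unfold outerRadius
  split_ifs <;> positivity

theorem half_pow_log_le {n : ℕ} (hn : 1 ≤ n) : (1 / 2 : ℝ) ^ (Nat.log 2 n + 2) ≤ 1 / (2 * n) := by
  have hn0 : (0 : ℝ) < n := by exact_mod_cast hn
  have h1 : n < 2 ^ (Nat.log 2 n + 1) := Nat.lt_pow_succ_log_self (by norm_num) n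
  have h2 : (n : ℝ) ≤ 2 ^ (Nat.log 2 n + 1) := by exact_mod_cast h1.le
  rw [div_pow, one_pow]
  apply one_div_le_one_div_of_le (by positivity)
  rw [pow_succ]
  linarith

/-- An ordinary tripled disc just reaches modulus `1 / √n`. The last one overshoots by `2 * 2⁻ᵏ /
√n`, and the cutoff `k = log₂ n + 2` keeps `2 * 2⁻ᵏ ≤ 1 / n`. -/
theorem abs_outerCenter_add_le {n : ℕ} (hn : 1 ≤ n) {k : ℕ} {σ : ℝ} (hσ : |σ| = 1) :
    |σ * (1 - (1 / 2) ^ k) / √n| + 3 * outerRadius n k ≤ (1 + 1 / n) / √n := by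
  have hn0 : (0 : ℝ) < n := by exact_mod_cast hn
  have h1 : (1 / 2 : ℝ) ^ k ≤ 1 := pow_le_one₀ (by norm_num) (by norm_num)
  rw [abs_div, abs_mul, hσ, one_mul, abs_of_nonneg (by linarith), abs_of_nonneg (Real.sqrt_nonneg _),
    outerRadius, ← mul_div_assoc, ← add_div]
  refine div_le_div_of_nonneg_right ?_ (Real.sqrt_nonneg _)
  split_ifs with h
  · subst h
    have h2 := half_pow_log_le hn
    have h3 : (1 : ℝ) / n = 2 * (1 / (2 * n)) := by field_simp
    rw [h3]
    linarith
  · have h3 : (0 : ℝ) ≤ 1 / n := by positivity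
    linarith

theorem exists_outerCenter_near {n : ℕ} (hn : 1 ≤ n) {v : ℝ} (hv : |v| ≤ 1 / √n) :
    ∃ i ∈ Finset.range (Nat.log 2 n + 3) ×ˢ ({1, -1} : Finset ℝ),
      |v - i.2 * (1 - (1 / 2) ^ i.1) / √n| ≤ outerRadius n i.1 := by
  have hn0 : (0 : ℝ) < √n := Real.sqrt_pos.2 (by exact_mod_cast hn)
  have hu : |v| * √n ≤ 1 := by rwa [le_div_iff₀ hn0] at hv
  have hu0 : 0 ≤ |v| * √n := by positivity
  obtain ⟨k, hk, h⟩ : ∃ k < Nat.log 2 n + 3,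
      abs ((1 - |v| * √n) - (1 / 2) ^ k) ≤ outerRadius n k * √n := by
    -- Dyadic discs never reach the endpoint `|v| = 1 / √n`; the enlarged last disc covers what
    -- remains.
    by_cases hs : 1 - |v| * √n ≤ 2 * (1 / 2) ^ (Nat.log 2 n + 2)
    · refine ⟨Nat.log 2 n + 2, by omega, ?_⟩
      rw [outerRadius, if_pos rfl, div_mul_cancel₀ _ hn0.ne', abs_le]
      constructor <;> linarith
    · obtain ⟨k, hk, h⟩ := exists_abs_sub_half_pow_le (s := 1 - |v| * √n) (by linarith)
        (Nat.log 2 n + 1) (by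
          rw [pow_succ] at hs
          have : (0 : ℝ) < (1 / 2) ^ (Nat.log 2 n + 1) := by positivity
          linarith)
      refine ⟨k, by omega, ?_⟩
      rwa [outerRadius, if_neg (by omega), div_mul_cancel₀ _ hn0.ne']
  have key : ∀ σ : ℝ, |σ| = 1 → v = σ * |v| →
      |v - σ * (1 - (1 / 2) ^ k) / √n| ≤ outerRadius n k := by
    intro σ hσ hv'
    have e : v - σ * (1 - (1 / 2) ^ k) / √n
        = σ * (-((1 - |v| * √n) - (1 / 2) ^ k) / √n) := by
      nth_rewrite 1 [hv']
      field_simp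
      ring
    rw [e, abs_mul, hσ, one_mul, abs_div, abs_neg, abs_of_pos hn0, div_le_iff₀ hn0]
    exact h
  rcases le_total 0 v with h0 | h0
  · exact ⟨(k, 1), by simp [hk], key 1 (by simp) (by rw [abs_of_nonneg h0, one_mul])⟩
  · exact ⟨(k, -1), by simp [hk], key (-1) (by simp) (by rw [abs_of_nonpos h0]; ring)⟩

theorem card_inner_roots_le {n L : ℕ} {S : Multiset ℝ} {a b : ℝ} (hab : a ≤ b) (ha : -√n ≤ a)
    (hb : b ≤ √n) (hS : ∀ x ∈ S, a ≤ x ∧ x ≤ b)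
    (hL : ∀ c ∈ innerCenters n, (S.filter fun x => |x - c| ≤ 1).card ≤ L) :
    (S.card : ℝ) ≤ (b - a + 2) * L := by
  have hsq : (√n : ℝ) < Nat.sqrt n + 1 := Real.real_sqrt_lt_nat_sqrt_succ
  -- `⌊a⌋` may be `-Nat.sqrt n - 1`, which is not an available centre; the `max` moves it up by one
  -- and still leaves each root within distance 1.
  set F : Finset ℤ := (Finset.Icc ⌊a⌋ ⌊b⌋).image fun j => max j (-(Nat.sqrt n : ℤ)) with hF
  have hFc : (F.card : ℝ) ≤ b - a + 2 := by
    have h1 : F.card ≤ (⌊b⌋ + 1 - ⌊a⌋).toNat := by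
      rw [← Int.card_Icc]; exact Finset.card_image_le
    have h2 : ⌊a⌋ ≤ ⌊b⌋ := Int.floor_le_floor hab
    have h3 : (F.card : ℤ) ≤ ⌊b⌋ + 1 - ⌊a⌋ := by omega
    have h4 : (F.card : ℝ) ≤ ⌊b⌋ + 1 - ⌊a⌋ := by exact_mod_cast h3
    linarith [Int.floor_le b, Int.lt_floor_add_one a]
  have h := Multiset.card_le_card_mul_of_cover (S := S) (F := F) (L := L)
    (fun j x => |x - (j : ℝ)| ≤ 1) (fun x hx => by
      obtain ⟨h1, h2⟩ := hS x hx
      refine ⟨max ⌊x⌋ (-(Nat.sqrt n : ℤ)), Finset.mem_image_of_mem _ (Finset.mem_Icc.2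
        ⟨Int.floor_le_floor h1, Int.floor_le_floor h2⟩), ?_⟩
      have h3 := Int.floor_le x
      have h4 := Int.lt_floor_add_one x
      rcases le_total ⌊x⌋ (-(Nat.sqrt n : ℤ)) with h5 | h5
      · rw [max_eq_right h5, abs_le]
        have h6 : (⌊x⌋ : ℝ) ≤ -(Nat.sqrt n : ℝ) := by exact_mod_cast h5
        push_cast
        constructor <;> linarith
      · rw [max_eq_left h5, abs_le]
        constructor <;> linarith) (fun j hj => by
      refine hL j (Finset.mem_image_of_mem _ ?_)
      obtain ⟨i, hi, rfl⟩ := Finset.mem_image.1 hj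
      rw [Finset.mem_Icc] at hi ⊢
      refine ⟨le_max_right _ _, max_le ?_ (by omega)⟩
      have h5 : (i : ℝ) < Nat.sqrt n + 1 :=
        lt_of_le_of_lt ((Int.cast_le.2 hi.2).trans ((Int.floor_le b).trans hb)) hsq
      have h6 : i < (Nat.sqrt n : ℤ) + 1 := by exact_mod_cast h5
      omega)
  calc (S.card : ℝ) ≤ F.card * L := by exact_mod_cast h
    _ ≤ _ := by gcongr

theorem sub_le_volume_real {J : Set ℝ} (hJ : J.OrdConnected) {s : ℝ} (hs : J ⊆ Set.Icc (-s) s)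
    {a b : ℝ} (ha : a ∈ J) (hb : b ∈ J) (hab : a ≤ b) : b - a ≤ volume.real J := by
  have h1 : volume.real (Set.Icc a b) ≤ volume.real J :=
    measureReal_mono (hJ.out ha hb) ((measure_mono hs).trans_lt measure_Icc_lt_top).ne
  rwa [Real.volume_real_Icc_of_le hab] at h1

theorem localLaw_of_bounds {n L : ℕ} (hn : 1 ≤ n) {a : ℕ → ℝ} {T δ : ℝ} (hδ : 0 < δ)
    (hT : ∑ k ∈ Finset.range (n + 1), a k ^ 2 ≤ T)
    (hin : ∀ c ∈ innerCenters n,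
      δ ^ 2 * ∑ k ∈ Finset.range (n + 1), (c ^ k / √(k.factorial : ℝ)) ^ 2
        ≤ (weylPolynomial n a).eval c ^ 2)
    (hout : ∀ c ∈ outerCenters n,
      δ ^ 2 * ∑ k ∈ Finset.range (n + 1), (c ^ (n - k) / √(k.factorial : ℝ)) ^ 2
        ≤ ((weylPolynomial n a).reflect n).eval c ^ 2)
    (hL : T * Real.exp 9 * (n + 3) < 4 ^ (L + 1) * δ ^ 2) :
    LocalLaw n (weylPolynomial n a) ((2 * Nat.log 2 n + 8) * L) := by
  have hn0 : (0 : ℝ) < n := by exact_mod_cast hn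
  have hsn : 0 < √(n : ℝ) := Real.sqrt_pos.2 hn0
  have hT0 : 0 ≤ T := le_trans (by positivity) hT
  have hp : weylPolynomial n a ≠ 0 := by
    intro h0
    -- At the centre 0 the variance is at least 1, from `0 ^ 0 = 1`, so the zero polynomial is
    -- excluded.
    have h1 := hin 0 (Finset.mem_image.2 ⟨0, by simp, by simp⟩)
    rw [h0, Polynomial.eval_zero] at h1
    have h2 : (1 : ℝ) ≤ ∑ k ∈ Finset.range (n + 1), ((0 : ℝ) ^ k / √(k.factorial : ℝ)) ^ 2 := by
      refine le_trans (by simp) (Finset.single_le_sum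
        (f := fun k : ℕ => ((0 : ℝ) ^ k / √(k.factorial : ℝ)) ^ 2)
        (fun k _ => sq_nonneg _) (Finset.mem_range.2 (Nat.succ_pos n)))
    have h3 : 0 < δ ^ 2 := by positivity
    nlinarith
  have hcard : ∀ N : ℕ, 4 ^ N * δ ^ 2 ≤ T * Real.exp 9 * (n + 3) → N ≤ L := by
    intro N hN
    by_contra hlt
    have h1 : (4 : ℝ) ^ (L + 1) ≤ 4 ^ N := pow_le_pow_right₀ (by norm_num) (by omega)
    have h2 : (4 : ℝ) ^ (L + 1) * δ ^ 2 ≤ 4 ^ N * δ ^ 2 := by gcongr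
    linarith
  refine ⟨hp, fun I hI => ?_⟩
  classical
  set J := I ∩ Set.Icc (-√(n : ℝ)) √n with hJ
  have hJc : J.OrdConnected := hI.inter Set.ordConnected_Icc
  set R := (weylPolynomial n a).roots with hR
  have hinner : ((R.filter fun x => x ∈ J).card : ℝ) ≤ (volume.real J + 2) * L := by
    set S := R.filter fun x => x ∈ J with hS
    by_cases hS0 : S = 0
    · rw [hS0, Multiset.card_zero, Nat.cast_zero]
      have : 0 ≤ volume.real J := measureReal_nonneg
      positivity
    -- The span from the least to the greatest root lies in `J`, so its length is at most that of
    -- `J` whatever the endpoints of `I`.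
    have hne : S.toFinset.Nonempty := by rwa [Multiset.toFinset_nonempty]
    have hmem : ∀ x ∈ S.toFinset, x ∈ J := fun x hx =>
      (Multiset.mem_filter.1 (Multiset.mem_toFinset.1 hx)).2
    have hmin := hmem _ (S.toFinset.min'_mem hne)
    have hmax := hmem _ (S.toFinset.max'_mem hne)
    have hle := S.toFinset.min'_le_max' hne
    have h1 := sub_le_volume_real hJc (Set.inter_subset_right) hmin hmax hle
    refine (card_inner_roots_le hle hmin.2.1 hmax.2.2 (fun x hx =>
      ⟨Finset.min'_le _ _ (Multiset.mem_toFinset.2 hx),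
        Finset.le_max' _ _ (Multiset.mem_toFinset.2 hx)⟩) (L := L) (fun c hc => ?_)).trans ?_
    · have hcn : c ^ 2 ≤ n := by
        obtain ⟨j, hj, rfl⟩ := Finset.mem_image.1 hc
        rw [Finset.mem_Icc] at hj
        exact sq_le_of_abs_le_natSqrt hj.1 hj.2
      exact hcard _ (weylPolynomial_card_roots_near_le hp
        ((Multiset.filter_le _ _).trans (Multiset.filter_le _ _)) hT hcn
        (fun b hb => (Multiset.mem_filter.1 hb).2) (hin c hc))
    · gcongr
  have houter : (R.filter fun x => x ∈ I ∧ x ∉ J).card ≤ (Nat.log 2 n + 3) * 2 * L := by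
    set S := R.filter fun x => x ∈ I ∧ x ∉ J with hS
    have hbig : ∀ x ∈ S, √(n : ℝ) < |x| := by
      intro x hx
      obtain ⟨h1, h2⟩ := (Multiset.mem_filter.1 hx).2
      by_contra h3
      exact h2 ⟨h1, abs_le.1 (not_lt.1 h3)⟩
    have hSinv : S.map (fun x => x⁻¹) ≤ ((weylPolynomial n a).reflect n).roots :=
      map_inv_le_roots_reflect hp (natDegree_weylPolynomial_le n a) (Multiset.filter_le _ _)
        fun x hx h0 => by
          have := hbig x hx
          rw [h0, abs_zero] at this
          exact absurd this (not_lt.2 hsn.le)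
    have h := Multiset.card_le_card_mul_of_cover (S := S.map fun x => x⁻¹)
      (F := Finset.range (Nat.log 2 n + 3) ×ˢ ({1, -1} : Finset ℝ)) (L := L)
      (fun i v => |v - i.2 * (1 - (1 / 2) ^ i.1) / √n| ≤ outerRadius n i.1) (fun v hv => by
        obtain ⟨x, hx, rfl⟩ := Multiset.mem_map.1 hv
        refine exists_outerCenter_near hn ?_
        rw [abs_inv, ← one_div]
        exact one_div_le_one_div_of_le hsn (hbig x hx).le) (fun i hi => by
        have hσ : |i.2| = 1 := by
          have h1 := (Finset.mem_product.1 hi).2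
          rw [Finset.mem_insert, Finset.mem_singleton] at h1
          rcases h1 with h1 | h1 <;> rw [h1] <;> simp
        refine hcard _ ((reflect_weylPolynomial_card_roots_near_le hn hp (outerRadius_pos hn i.1)
          ((Multiset.filter_le _ _).trans hSinv) hT (abs_outerCenter_add_le hn hσ)
          (fun b hb => (Multiset.mem_filter.1 hb).2)
          (hout _ (Finset.mem_image_of_mem _ hi))).trans ?_)
        gcongr <;> norm_num)
    rw [Multiset.card_map, Finset.card_product, Finset.card_range] at h
    exact h.trans (Nat.mul_le_mul_right _ (Nat.mul_le_mul_left _ Finset.card_le_two))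
  have hsplit : realRootCount (weylPolynomial n a) I
      ≤ (R.filter fun x => x ∈ J).card + (R.filter fun x => x ∈ I ∧ x ∉ J).card := by
    rw [realRootCount, ← Multiset.card_add]
    have e1 : R.filter (fun x => x ∈ J) = (R.filter fun x => x ∈ I).filter fun x => x ∈ J := by
      rw [Multiset.filter_filter]
      exact Multiset.filter_congr fun x _ => ⟨fun h => ⟨h, h.1⟩, fun h => h.1⟩
    have e2 : R.filter (fun x => x ∈ I ∧ x ∉ J)
        = (R.filter fun x => x ∈ I).filter fun x => x ∉ J := by
      rw [Multiset.filter_filter]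
      exact Multiset.filter_congr fun x _ => and_comm
    rw [e1, e2, Multiset.filter_add_not]
  have h1 : (realRootCount (weylPolynomial n a) I : ℝ)
      ≤ ((R.filter fun x => x ∈ J).card : ℝ) + (R.filter fun x => x ∈ I ∧ x ∉ J).card := by
    exact_mod_cast hsplit
  have h2 : ((R.filter fun x => x ∈ I ∧ x ∉ J).card : ℝ) ≤ (Nat.log 2 n + 3) * 2 * L := by
    exact_mod_cast houter
  have hv : 0 ≤ volume.real J := measureReal_nonneg
  have hL0 : (0 : ℝ) ≤ L := Nat.cast_nonneg L
  have hl0 : (0 : ℝ) ≤ Nat.log 2 n := Nat.cast_nonneg _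
  have h3 : 0 ≤ volume.real J * L := by positivity
  have h4 : 0 ≤ volume.real J * L * Nat.log 2 n := by positivity
  calc (realRootCount (weylPolynomial n a) I : ℝ)
      ≤ (volume.real J + 2) * L + (Nat.log 2 n + 3) * 2 * L := by linarith
    _ ≤ (1 + volume.real J) * ((2 * Nat.log 2 n + 8) * L) := by linarith

/-! ### Gaussian small ball and moment estimates -/

theorem hasLaw_sum_mul_gaussianReal {Ω : Type*} [MeasurableSpace Ω] {P : Measure Ω}
    [IsProbabilityMeasure P] {ξ : ℕ → Ω → ℝ} (hind : iIndepFun ξ P)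
    (hlaw : ∀ k, HasLaw (ξ k) (gaussianReal 0 1) P) (b : ℕ → ℝ) (s : Finset ℕ) :
    HasLaw (fun ω => ∑ k ∈ s, b k * ξ k ω)
      (gaussianReal 0 (∑ k ∈ s, NNReal.mk (b k ^ 2) (sq_nonneg _))) P := by
  have hlaw' : ∀ k, HasLaw (fun ω => b k * ξ k ω) (gaussianReal 0 (NNReal.mk (b k ^ 2) (sq_nonneg _))) P :=
    fun k => by simpa using gaussianReal_const_mul (hlaw k) (b k)
  have hind' : iIndepFun (fun k ω => b k * ξ k ω) P :=
    hind.comp (fun k x => b k * x) fun k => by fun_prop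
  induction s using Finset.induction_on with
  | empty =>
    refine ⟨by fun_prop, ?_⟩
    simp
  | insert i s hi ih =>
    have h := hind'.indepFun_finsetSum_of_notMem₀ (fun k => (hlaw' k).aemeasurable) hi
    have e : (∑ j ∈ s, fun ω => b j * ξ j ω) = fun ω => ∑ k ∈ s, b k * ξ k ω := by
      ext ω; simp
    rw [e] at h
    have h1 := gaussianReal_add_gaussianReal_of_indepFun h.symm (hlaw' i).map_eq ih.map_eq
    rw [Finset.sum_insert hi]
    simp only [Finset.sum_insert hi]
    refine ⟨(hlaw' i).aemeasurable.add ih.aemeasurable, ?_⟩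
    rw [add_zero] at h1
    exact h1

/-- The density is at most `1 / √(2πv)` on an interval of length `2δ√v`, and `2 ≤ √(2π)`. Strictness
makes the event empty when `v = 0`. -/
theorem measureReal_sq_lt_le {Ω : Type*} [MeasurableSpace Ω] {P : Measure Ω} {Y : Ω → ℝ}
    {v : NNReal} (hY : HasLaw Y (gaussianReal 0 v) P) {δ : ℝ} (hδ : 0 ≤ δ) :
    P.real {ω | Y ω ^ 2 < δ ^ 2 * v} ≤ δ := by
  by_cases hv : v = 0
  · have : {ω | Y ω ^ 2 < δ ^ 2 * (v : ℝ)} = ∅ := by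
      ext ω
      simp [hv, sq_nonneg]
    rw [this]
    simpa using hδ
  have hv0 : (0 : ℝ) < v := by exact_mod_cast pos_iff_ne_zero.2 hv
  have hmeas : MeasurableSet {x : ℝ | x ^ 2 < δ ^ 2 * v} :=
    measurableSet_lt (by fun_prop) (by fun_prop)
  rw [hY.measureReal_eq hmeas]
  have hset : {x : ℝ | x ^ 2 < δ ^ 2 * v} ⊆ Set.Icc (-(δ * √v)) (δ * √v) := by
    intro x hx
    have h1 : x ^ 2 ≤ (δ * √v) ^ 2 := by
      rw [mul_pow, Real.sq_sqrt hv0.le]; exact le_of_lt hx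
    exact abs_le.1 (abs_le_of_sq_le_sq h1 (by positivity))
  refine (measureReal_mono hset).trans ?_
  have hs : 0 ≤ δ * √v := by positivity
  have hpdf : ∀ x, gaussianPDF 0 v x ≤ ENNReal.ofReal (√(2 * Real.pi * v))⁻¹ := by
    intro x
    refine ENNReal.ofReal_le_ofReal ?_
    rw [gaussianPDFReal]
    refine mul_le_of_le_one_right (by positivity) (Real.exp_le_one_iff.2 ?_)
    rw [neg_div]
    exact neg_nonpos.2 (by positivity)
  have h2 : gaussianReal 0 v (Set.Icc (-(δ * √v)) (δ * √v)) ≤ ENNReal.ofReal δ := by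
    rw [gaussianReal_apply 0 hv]
    calc ∫⁻ x in Set.Icc (-(δ * √v)) (δ * √v), gaussianPDF 0 v x
        ≤ ∫⁻ _ in Set.Icc (-(δ * √v)) (δ * √v), ENNReal.ofReal (√(2 * Real.pi * v))⁻¹ :=
          lintegral_mono fun x => hpdf x
      _ = ENNReal.ofReal ((√(2 * Real.pi * v))⁻¹ * (2 * (δ * √v))) := by
          rw [setLIntegral_const, Real.volume_Icc, ← ENNReal.ofReal_mul (by positivity)]
          ring_nf
      _ ≤ ENNReal.ofReal δ := by
          refine ENNReal.ofReal_le_ofReal ?_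
          have h3 : 2 * √v ≤ √(2 * Real.pi * v) := by
            refine Real.le_sqrt_of_sq_le ?_
            rw [mul_pow, Real.sq_sqrt hv0.le]
            nlinarith [Real.pi_gt_three]
          rw [inv_mul_le_iff₀ (by positivity)]
          nlinarith
  exact ENNReal.toReal_le_of_le_ofReal hδ h2

theorem measureReal_sq_sum_mul_lt_le {Ω : Type*} [MeasurableSpace Ω] {P : Measure Ω}
    [IsProbabilityMeasure P] {ξ : ℕ → Ω → ℝ} (hind : iIndepFun ξ P)
    (hlaw : ∀ k, HasLaw (ξ k) (gaussianReal 0 1) P) (b : ℕ → ℝ) (s : Finset ℕ) {δ : ℝ}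
    (hδ : 0 ≤ δ) :
    P.real {ω | (∑ k ∈ s, b k * ξ k ω) ^ 2 < δ ^ 2 * ∑ k ∈ s, b k ^ 2} ≤ δ := by
  have h := measureReal_sq_lt_le (hasLaw_sum_mul_gaussianReal hind hlaw b s) hδ
  simpa only [NNReal.coe_sum, NNReal.coe_mk] using h

/-- Markov's inequality, each square having mean 1. -/
theorem measureReal_lt_sum_sq_le {Ω : Type*} [MeasurableSpace Ω] {P : Measure Ω}
    [IsProbabilityMeasure P] {ξ : ℕ → Ω → ℝ} (hlaw : ∀ k, HasLaw (ξ k) (gaussianReal 0 1) P)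
    (s : Finset ℕ) {T : ℝ} (hT : 0 < T) :
    P.real {ω | T < ∑ k ∈ s, ξ k ω ^ 2} ≤ s.card / T := by
  have hint : ∀ k, Integrable (fun ω => ξ k ω ^ 2) P := fun k => by
    have h1 : MemLp id 2 (P.map (ξ k)) := by
      rw [(hlaw k).map_eq]; exact memLp_id_gaussianReal 2
    exact ((memLp_map_measure_iff (by fun_prop) (hlaw k).aemeasurable).1 h1).integrable_sq
  have hval : ∀ k, ∫ ω, ξ k ω ^ 2 ∂P = 1 := fun k => by
    have h1 := (hlaw k).integral_comp (f := fun x : ℝ => x ^ 2) (by fun_prop)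
    have h2 : Var[fun x ↦ x; gaussianReal 0 1] = ∫ x, x ^ 2 ∂gaussianReal 0 1 :=
      variance_of_integral_eq_zero (by fun_prop) integral_id_gaussianReal
    rw [variance_fun_id_gaussianReal] at h2
    simpa [← h2, Function.comp_def] using h1
  have h := mul_meas_ge_le_integral_of_nonneg (μ := P) (f := fun ω => ∑ k ∈ s, ξ k ω ^ 2)
    (Eventually.of_forall fun ω => Finset.sum_nonneg fun k _ => sq_nonneg _)
    (integrable_finsetSum _ fun k _ => hint k) T
  rw [integral_finsetSum _ fun k _ => hint k] at h
  simp only [hval, Finset.sum_const, nsmul_eq_mul, mul_one] at h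
  rw [le_div_iff₀ hT, mul_comm]
  refine le_trans ?_ h
  exact mul_le_mul_of_nonneg_left (measureReal_mono fun ω (hω : T < _) => hω.le) hT.le

theorem measureReal_biUnion_le_card_mul {Ω : Type*} [MeasurableSpace Ω] {P : Measure Ω}
    [IsProbabilityMeasure P] {F : Finset ℝ} {E : ℝ → Set Ω} {δ : ℝ}
    (h : ∀ c ∈ F, P.real (E c) ≤ δ) : P.real (⋃ c ∈ F, E c) ≤ F.card * δ := by
  refine (measureReal_biUnion_finset_le F E).trans ((Finset.sum_le_sum h).trans_eq ?_)
  simp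

/-! ### Failure probability of the local law -/

theorem measureReal_not_localLaw_le {n L : ℕ} (hn : 1 ≤ n) {C : ℝ} {Ω : Type*} [MeasurableSpace Ω]
    {P : Measure Ω} [IsProbabilityMeasure P] {ξ : ℕ → Ω → ℝ} (hind : iIndepFun ξ P)
    (hlaw : ∀ k, HasLaw (ξ k) (gaussianReal 0 1) P)
    (hL : (n : ℝ) ^ (3 * C + 3) * Real.exp 9 * (n + 3) < 4 ^ (L + 1)) :
    P.real {ω | ¬ LocalLaw n (weylPolynomial n fun k => ξ k ω) ((2 * Nat.log 2 n + 8) * L)}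
      ≤ 13 * (n : ℝ) ^ (-C) := by
  have hn0 : (0 : ℝ) < n := by exact_mod_cast hn
  have hn1 : (1 : ℝ) ≤ n := by exact_mod_cast hn
  -- Taking `T = 1 / δ` bounds the total failure probability by `(5n + 8) * δ ≤ 13 * n ^ (-C)`,
  -- while `T / δ ^ 2` is the power `n ^ (3C + 3)` in `hL`.
  set T : ℝ := (n : ℝ) ^ (C + 1) with hT
  set δ : ℝ := (n : ℝ) ^ (-(C + 1)) with hδ
  have hT0 : 0 < T := Real.rpow_pos_of_pos hn0 _
  have hδ0 : 0 < δ := Real.rpow_pos_of_pos hn0 _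
  have hTδ : T⁻¹ = δ := (Real.rpow_neg hn0.le _).symm
  have hnδ : n * δ = (n : ℝ) ^ (-C) := by
    rw [hδ, show -C = 1 + -(C + 1) by ring, Real.rpow_add hn0, Real.rpow_one]
  have hL' : T * Real.exp 9 * (n + 3) < 4 ^ (L + 1) * δ ^ 2 := by
    have e : (n : ℝ) ^ (3 * C + 3) = T / δ ^ 2 := by
      rw [← hTδ, hT, show 3 * C + 3 = (C + 1) + (C + 1) + (C + 1) by ring, Real.rpow_add hn0,
        Real.rpow_add hn0]
      field_simp
    rw [e] at hL
    calc T * Real.exp 9 * (n + 3) = T / δ ^ 2 * Real.exp 9 * (n + 3) * δ ^ 2 := by field_simp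
      _ < 4 ^ (L + 1) * δ ^ 2 := by gcongr
  set E0 : Set Ω := {ω | T < ∑ k ∈ Finset.range (n + 1), ξ k ω ^ 2} with hE0
  set E1 : ℝ → Set Ω := fun c => {ω | (∑ k ∈ Finset.range (n + 1),
    c ^ k / √(k.factorial : ℝ) * ξ k ω) ^ 2
      < δ ^ 2 * ∑ k ∈ Finset.range (n + 1), (c ^ k / √(k.factorial : ℝ)) ^ 2} with hE1
  set E2 : ℝ → Set Ω := fun c => {ω | (∑ k ∈ Finset.range (n + 1),
    c ^ (n - k) / √(k.factorial : ℝ) * ξ k ω) ^ 2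
      < δ ^ 2 * ∑ k ∈ Finset.range (n + 1), (c ^ (n - k) / √(k.factorial : ℝ)) ^ 2} with hE2
  have hsub : {ω | ¬ LocalLaw n (weylPolynomial n fun k => ξ k ω) ((2 * Nat.log 2 n + 8) * L)}
      ⊆ E0 ∪ ((⋃ c ∈ innerCenters n, E1 c) ∪ ⋃ c ∈ outerCenters n, E2 c) := by
    intro ω hω
    by_contra h
    rw [Set.mem_union, Set.mem_union, not_or, not_or] at h
    obtain ⟨h0, h1, h2⟩ := h
    refine hω (localLaw_of_bounds hn hδ0 (not_lt.1 h0) (fun c hc => ?_) (fun c hc => ?_) hL')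
    · rw [eval_weylPolynomial]
      exact not_lt.1 fun h3 => h1 (Set.mem_biUnion hc h3)
    · rw [eval_reflect_weylPolynomial]
      exact not_lt.1 fun h3 => h2 (Set.mem_biUnion hc h3)
  have b0 : P.real E0 ≤ (n + 1) * δ := by
    refine (measureReal_lt_sum_sq_le hlaw _ hT0).trans_eq ?_
    rw [div_eq_mul_inv, hTδ, Finset.card_range]
    push_cast
    rfl
  have b1 : P.real (⋃ c ∈ innerCenters n, E1 c) ≤ (2 * n + 1) * δ := by
    refine (measureReal_biUnion_le_card_mul fun c _ =>
      measureReal_sq_sum_mul_lt_le hind hlaw (fun k => c ^ k / √(k.factorial : ℝ)) _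
        hδ0.le).trans ?_
    gcongr
    have h := card_innerCenters_le n
    have h' := Nat.sqrt_le_self n
    exact_mod_cast (show (innerCenters n).card ≤ 2 * n + 1 by omega)
  have b2 : P.real (⋃ c ∈ outerCenters n, E2 c) ≤ (2 * n + 6) * δ := by
    refine (measureReal_biUnion_le_card_mul fun c _ =>
      measureReal_sq_sum_mul_lt_le hind hlaw (fun k => c ^ (n - k) / √(k.factorial : ℝ)) _
        hδ0.le).trans ?_
    gcongr
    have h := card_outerCenters_le n
    have h' := Nat.log_le_self 2 n
    exact_mod_cast (show (outerCenters n).card ≤ 2 * n + 6 by omega)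
  have h3 := measureReal_union_le (μ := P) E0
    ((⋃ c ∈ innerCenters n, E1 c) ∪ ⋃ c ∈ outerCenters n, E2 c)
  have h4 := measureReal_union_le (μ := P) (⋃ c ∈ innerCenters n, E1 c) (⋃ c ∈ outerCenters n, E2 c)
  refine (measureReal_mono hsub).trans ?_
  rw [← hnδ]
  nlinarith

/-! ### Absorbing logarithms into `n ^ ε_n` -/

theorem LocalLaw.mono {n : ℕ} {p : Polynomial ℝ} {B B' : ℝ} (h : LocalLaw n p B) (hB : B ≤ B') :
    LocalLaw n p B' := by
  refine ⟨h.1, fun I hI => (h.2 I hI).trans ?_⟩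
  have : 0 ≤ volume.real (I ∩ Set.Icc (-√(n : ℝ)) √n) := measureReal_nonneg
  gcongr

/-- Used with `s = √(log n)`. The left side is at most `12 * κ * s ^ 4`, and `1440 = 12 * 5!` makes
the fifth term of the exponential series dominate it. -/
theorem poly_mul_le_exp {κ s : ℝ} (hκ : 1 ≤ κ) (hs : 1440 * κ ≤ s) :
    (4 * s ^ 2 + 8) * (κ * s ^ 2) ≤ Real.exp s := by
  have hs1 : 1 ≤ s := by linarith
  have h1 := Real.pow_div_factorial_le_exp s (by linarith) 5
  have h2 : (5 : ℕ).factorial = 120 := by decide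
  rw [h2] at h1
  have h3 : 1 ≤ s ^ 2 := one_le_pow₀ hs1
  calc (4 * s ^ 2 + 8) * (κ * s ^ 2) ≤ (12 * s ^ 2) * (κ * s ^ 2) := by gcongr; linarith
    _ = (1440 * κ) * s ^ 4 / 120 := by ring
    _ ≤ s * s ^ 4 / 120 := by gcongr
    _ = s ^ 5 / 120 := by ring
    _ ≤ Real.exp s := by exact_mod_cast h1

theorem natLog_two_le_two_mul_log {n : ℕ} (hn : 1 ≤ n) : (Nat.log 2 n : ℝ) ≤ 2 * Real.log n := by
  have h1 : ((2 : ℝ)) ^ Nat.log 2 n ≤ n := by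
    exact_mod_cast Nat.pow_log_le_self 2 (by omega)
  have h2 := Real.log_le_log (by positivity) h1
  rw [Real.log_pow] at h2
  have h3 : (0 : ℝ) ≤ Nat.log 2 n := Nat.cast_nonneg _
  nlinarith [Real.log_two_gt_d9]

theorem exp_nine_le : Real.exp 9 ≤ 10000 := by
  have h : Real.exp 9 = Real.exp 1 ^ 9 := by rw [← Real.exp_nat_mul]; norm_num
  rw [h]
  calc Real.exp 1 ^ 9 ≤ 2.7182818286 ^ 9 := by gcongr; exact Real.exp_one_lt_d9.le
    _ ≤ 10000 := by norm_num

theorem lemma4p1 :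
    ∃ (A : ℝ) (ε : ℕ → ℝ), 0 < A ∧ Tendsto ε atTop (𝓝 0) ∧
      ∀ C : ℝ, 0 < C → ∃ K : ℝ, 0 < K ∧ ∀ n : ℕ, 1 ≤ n →
        ∀ (Ω : Type*) [MeasurableSpace Ω] (P : Measure Ω) [IsProbabilityMeasure P]
          (ξ : ℕ → Ω → ℝ), iIndepFun ξ P → (∀ k, HasLaw (ξ k) (gaussianReal 0 1) P) →
          P.real {ω | ¬ LocalLaw n (weylPolynomial n (fun k => ξ k ω)) (A * (n : ℝ) ^ (ε n))}
            ≤ K * (n : ℝ) ^ (-C) := by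
  have hlim : Tendsto (fun n : ℕ => √(Real.log n)) atTop atTop :=
    Real.tendsto_sqrt_atTop.comp (Real.tendsto_log_atTop.comp tendsto_natCast_atTop_atTop)
  refine ⟨1, fun n => (√(Real.log n))⁻¹, one_pos, hlim.inv_tendsto_atTop, fun C hC => ?_⟩
  -- For `n ≥ 10000`, `exp 9 ≤ n` and `n + 3 ≤ n ^ 2` add three to the exponent `3 * C + 3`.
  set κ : ℝ := 3 * C + 6 with hκ
  obtain ⟨N, hN⟩ := eventually_atTop.1
    ((hlim.eventually_ge_atTop (1440 * κ)).and (eventually_ge_atTop 10000))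
  refine ⟨13 + (N : ℝ) ^ C, by positivity, fun n hn Ω _ P _ ξ hind hlaw => ?_⟩
  have hn0 : (0 : ℝ) < n := by exact_mod_cast hn
  have hpow : 0 ≤ (n : ℝ) ^ (-C) := by positivity
  -- For `n < N` the term `N ^ C` in the constant makes the bound exceed 1, so only this constant,
  -- and not `ε`, depends on `C`.
  rcases lt_or_ge n N with hlt | hge
  · refine measureReal_le_one.trans ?_
    have h1 : (1 : ℝ) ≤ (N : ℝ) ^ C * (n : ℝ) ^ (-C) := by
      calc (1 : ℝ) = (n : ℝ) ^ C * (n : ℝ) ^ (-C) := by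
            rw [← Real.rpow_add hn0, add_neg_cancel, Real.rpow_zero]
        _ ≤ _ := by gcongr
    linarith
  · obtain ⟨hs, hbig⟩ := hN n hge
    have hbig' : (10000 : ℝ) ≤ n := by exact_mod_cast hbig
    have hlog : 0 ≤ Real.log n := Real.log_nonneg (by linarith)
    have hsq : √(Real.log n) ^ 2 = Real.log n := Real.sq_sqrt hlog
    have hspos : 0 < √(Real.log n) := lt_of_lt_of_le (by linarith) hs
    set L := ⌊κ * Real.log n⌋₊ with hLdef
    have hL : (n : ℝ) ^ (3 * C + 3) * Real.exp 9 * (n + 3) < 4 ^ (L + 1) := by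
      calc (n : ℝ) ^ (3 * C + 3) * Real.exp 9 * (n + 3)
          ≤ (n : ℝ) ^ (3 * C + 3) * n * n ^ 2 := by
            gcongr
            · exact exp_nine_le.trans hbig'
            · nlinarith
        _ = (n : ℝ) ^ κ := by
            rw [mul_assoc, show (n : ℝ) * n ^ 2 = (n : ℝ) ^ (3 : ℝ) by norm_cast; ring,
              ← Real.rpow_add hn0, hκ]
            ring_nf
        _ = Real.exp (κ * Real.log n) := by rw [Real.rpow_def_of_pos hn0, mul_comm]
        _ < Real.exp ((L + 1 : ℕ) * 1) := by
            rw [Real.exp_lt_exp, mul_one]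
            push_cast
            exact Nat.lt_floor_add_one _
        _ = Real.exp 1 ^ (L + 1) := by rw [Real.exp_nat_mul]
        _ ≤ 4 ^ (L + 1) := by
            gcongr
            linarith [Real.exp_one_lt_d9]
    have hB : ((2 * Nat.log 2 n + 8) * L : ℝ) ≤ 1 * (n : ℝ) ^ (√(Real.log n))⁻¹ := by
      have e : Real.log n * (√(Real.log n))⁻¹ = √(Real.log n) := by
        nth_rewrite 1 [← hsq]
        field_simp
      rw [one_mul, Real.rpow_def_of_pos hn0, e]
      refine le_trans ?_ (poly_mul_le_exp (by linarith : 1 ≤ κ) hs)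
      rw [hsq]
      have h1 := natLog_two_le_two_mul_log hn
      have h2 : (L : ℝ) ≤ κ * Real.log n := Nat.floor_le (by positivity)
      exact mul_le_mul (by linarith) h2 (Nat.cast_nonneg _) (by linarith)
    calc P.real {ω | ¬ LocalLaw n (weylPolynomial n fun k => ξ k ω)
              (1 * (n : ℝ) ^ (√(Real.log n))⁻¹)}
        ≤ P.real {ω | ¬ LocalLaw n (weylPolynomial n fun k => ξ k ω)
              ((2 * Nat.log 2 n + 8) * L)} :=
          measureReal_mono fun ω hω h => hω (h.mono hB)
      _ ≤ 13 * (n : ℝ) ^ (-C) := measureReal_not_localLaw_le hn hind hlaw hL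
      _ ≤ _ := by
          have : (0 : ℝ) ≤ (N : ℝ) ^ C := by positivity
          gcongr
          linarith
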